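/- Let $N\ge 2$ and equip $\mathbb{R}^N$ with its Euclidean norm $\|\cdot\|$. For a locally Lipschitz function $f:\mathbb{R}^N\to\mathbb{R}$ and $x\in\mathbb{R}^N$, let $$\partial f(x)=\mathrm{conv}\Big\{\lim_{n\to\infty}\nabla f(x_n)\;:\; x_n\to x,\ f \text{ differentiable at each } x_n,\ \big(\nabla f(x_n)\big)_n \text{ convergent}\Big\}$$ denote the Clarke subdifferential of $f$ at $x$, where $\mathrm{conv}$ is the convex hull. A function $f$ is called $L$-Lipschitz if $|f(x)-f(y)|\le L\|x-y\|$ for all $x,y$. Let $C\subset\mathbb{R}^N$ be a compact convex set with $0\in C$, and let $L:=\max_{x\in C}\|x\|$. Then: (i) There is an everywhere differentiable, $L$-Lipschitz, compactly supported function $f:\mathbb{R}^N\to\mathbb{R}$ such that for every compact convex set $K\subset C$ with $0\in K$ there exists $x\in\mathbb{R}^N$ with $\partial f(x)=K$. (ii) If moreover $0\in\mathrm{int}(C)$, then there is a function $f$ as in (i) which in addition satisfies $\partial f(x)\subset C$ for all $x\in\mathbb{R}^N$. -/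

import Mathlib

open Set Filter Topology
open scoped NNReal

/-- The set of all limits of gradients `lim ∇f(xₙ)` along sequences `xₙ → x` of points at which
`f` is differentiable. -/
def limitingGradients {N : ℕ} (f : EuclideanSpace ℝ (Fin N) → ℝ)
    (x : EuclideanSpace ℝ (Fin N)) : Set (EuclideanSpace ℝ (Fin N)) :=
  {p | ∃ u : ℕ → EuclideanSpace ℝ (Fin N),
    (∀ n, DifferentiableAt ℝ f (u n)) ∧
    Tendsto u atTop (𝓝 x) ∧
    Tendsto (fun n => gradient f (u n)) atTop (𝓝 p)}

/-- The Clarke subdifferential `∂f(x)` of a (locally Lipschitz) function on `ℝᴺ`: the convex hull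
of the set of limits of gradients of `f` at points of differentiability converging to `x`. -/
def clarkeSubdifferential {N : ℕ} (f : EuclideanSpace ℝ (Fin N) → ℝ)
    (x : EuclideanSpace ℝ (Fin N)) : Set (EuclideanSpace ℝ (Fin N)) :=
  convexHull ℝ (limitingGradients f x)

/-- The family `𝒦_C` of nonempty compact convex subsets of `C`. -/
def compactConvexSubsets {N : ℕ} (C : Set (EuclideanSpace ℝ (Fin N))) :
    Set (Set (EuclideanSpace ℝ (Fin N))) :=
  {K | K ⊆ C ∧ K.Nonempty ∧ IsCompact K ∧ Convex ℝ K}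

/-- The family `𝒦⁰_C` of compact convex subsets of `C` that contain `0`. -/
def compactConvexSubsetsZero {N : ℕ} (C : Set (EuclideanSpace ℝ (Fin N))) :
    Set (Set (EuclideanSpace ℝ (Fin N))) :=
  {K | K ∈ compactConvexSubsets C ∧ 0 ∈ K}

/-!
Every compact convex `K ⊆ C` containing `0` is a Hausdorff limit of finite sets from one sequence
`F k ∋ 0`. Parametrising the compact hyperspace of `C` by the Cantor set attaches to `F k` a number
`t k ∈ [0, 1]` such that, for a suitable `x` depending on `K`, the sets `F k` tend to `K` as `k → ∞`
and `t k → x`. Near the point `(t k, 2⁻ᵏ)` of a coordinate plane we place a bump of size at most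
`4⁻ᵏ / 4` whose gradients stay close to the convex hull of `F k` and almost attain each point of
`F k`. The bumps are quadratically small in the distance to the axis, so their sum is differentiable
with zero gradient there; and since only the bumps with `k` large and `t k` close to `x` come near
`(x, 0)`, the gradients cluster at `(x, 0)` exactly along `K`.

For a bump, replace the support function of a finite set `F` by its log-sum-exp approximation `g`
and cut off `g - c (r² - ‖·‖²)` smoothly at height zero. Its gradients are nearly multiples by
factors in `[0, 1]` of those of `g`, hence close to the convex hull of `F`. For `q ∈ F` and
`a < 1`, subtracting the linear form `⟪a • q, ·⟫` creates an interior minimum, where the gradient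
of the bump is `a • q`.

If `0` is not interior to `C`, the construction for the ball of radius `L` gives part (i).
-/

open Metric TopologicalSpace
open scoped Gradient RealInnerProductSpace

theorem exists_seq_forall_mapClusterPt (X : Type*) [TopologicalSpace X] [SeparableSpace X]
    [Nonempty X] : ∃ s : ℕ → X, ∀ x, MapClusterPt x atTop s := by
  refine ⟨fun k => denseSeq X k.unpair.1, fun x => mapClusterPt_iff_frequently.2 fun U hU => ?_⟩
  obtain ⟨m, hm⟩ := (denseRange_denseSeq X).exists_mem_open isOpen_interior
    ⟨x, mem_interior_iff_mem_nhds.2 hU⟩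
  refine frequently_atTop.2 fun n => ⟨Nat.pair m n, Nat.right_le_pair m n, ?_⟩
  simpa only [Nat.unpair_pair] using interior_subset hm

theorem exists_seq_tendsto_comap_of_isCompact_closure {X : Type*} [MetricSpace X] {D : Set X}
    (hne : D.Nonempty) (hD : IsCompact (closure D)) :
    ∃ (t : ℕ → ℝ) (p : ℕ → X), (∀ k, t k ∈ Icc 0 1) ∧ (∀ k, p k ∈ D) ∧
      ∀ a ∈ closure D, ∃ x,
        (atTop ⊓ comap t (𝓝 x)).NeBot ∧ Tendsto p (atTop ⊓ comap t (𝓝 x)) (𝓝 a) := by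
  have := hne.closure.to_subtype
  have := isCompact_iff_compactSpace.1 hD
  obtain ⟨ψ, hψ, hψ_surj⟩ := exists_nat_bool_continuous_surjective_of_compact (closure D)
  obtain ⟨s, hs⟩ := exists_seq_forall_mapClusterPt (ℕ → Bool)
  let e : (ℕ → Bool) → ℝ := fun z => cantorSetHomeomorphNatToBool.symm z
  have he : IsInducing e :=
    IsInducing.subtypeVal.comp cantorSetHomeomorphNatToBool.symm.isInducing
  choose p hpD hp using fun k : ℕ =>
    mem_closure_iff.1 (ψ (s k)).2 _ (Nat.one_div_pos_of_nat (α := ℝ) (n := k))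
  refine ⟨e ∘ s, p, fun k => cantorSet_subset_unitInterval (Subtype.coe_prop _), hpD,
    fun a ha => ?_⟩
  obtain ⟨z, hz⟩ := hψ_surj ⟨a, ha⟩
  have hcomap : comap (e ∘ s) (𝓝 (e z)) = comap s (𝓝 z) := by
    rw [← comap_comap, ← he.nhds_eq_comap]
  rw [← show (ψ z : X) = a from congrArg Subtype.val hz]
  refine ⟨e z, ?_, ?_⟩ <;> rw [hcomap]
  · rw [neBot_inf_comap_iff_map, inf_comm]
    exact hs z
  · have hlim : Tendsto (fun k => (ψ (s k) : X)) (atTop ⊓ comap s (𝓝 z)) (𝓝 (ψ z)) :=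
      ((continuous_subtype_val.comp hψ).tendsto z).comp (tendsto_comap.mono_left inf_le_right)
    have hdist : Tendsto (fun k => dist (ψ (s k) : X) (p k)) (atTop ⊓ comap s (𝓝 z)) (𝓝 0) :=
      (squeeze_zero (fun _ => dist_nonneg) (fun k => (hp k).le)
        tendsto_one_div_add_atTop_nhds_zero_nat).mono_left inf_le_left
    exact (tendsto_iff_of_dist hdist).1 hlim

theorem exists_seq_finite_tendsto_comap {E : Type*} [NormedAddCommGroup E] [NormedSpace ℝ E]
    {C : Set E} (hC : IsCompact C) (hconv : Convex ℝ C) (h0 : 0 ∈ interior C) :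
    ∃ (t : ℕ → ℝ) (F : ℕ → NonemptyCompacts E), (∀ k, t k ∈ Icc 0 1) ∧
      (∀ k, (F k : Set E).Finite ∧ 0 ∈ F k ∧ (F k : Set E) ⊆ interior C) ∧
      ∀ K : NonemptyCompacts E, (K : Set E) ⊆ C → 0 ∈ K → ∃ x,
        (atTop ⊓ comap t (𝓝 x)).NeBot ∧ Tendsto F (atTop ⊓ comap t (𝓝 x)) (𝓝 K) := by
  let D := {K : NonemptyCompacts E | (K : Set E).Finite ∧ (K : Set E) ⊆ interior C}
  have hclosure : closure D = {K : NonemptyCompacts E | (K : Set E) ⊆ C} := by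
    rw [NonemptyCompacts.closure_finite_subsets,
      hconv.closure_interior_eq_closure_of_nonempty_interior ⟨0, h0⟩, hC.isClosed.closure_eq]
  have hzero : {0} ∈ D := ⟨by simp, by simpa using h0⟩
  obtain ⟨t, p, ht, hp, hlim⟩ := exists_seq_tendsto_comap_of_isCompact_closure ⟨_, hzero⟩
    (hclosure ▸ NonemptyCompacts.isCompact_subsets_of_isCompact hC)
  refine ⟨t, fun k => p k ⊔ {0}, ht, fun k => ⟨?_, ?_, ?_⟩, fun K hKC hK => ?_⟩
  · simpa using (hp k).1
  · simp [← SetLike.mem_coe]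
  · simpa [insert_subset_iff] using ⟨h0, (hp k).2⟩
  obtain ⟨x, hx, hpx⟩ := hlim K (hclosure ▸ hKC)
  have hsup : K ⊔ {0} = K := sup_eq_left.2 (by simpa [← SetLike.coe_subset_coe] using hK)
  exact ⟨x, hx, hsup ▸ hpx.sup_nhds tendsto_const_nhds⟩

theorem hasFDerivAt_zero_of_norm_le_norm_sub_sq {E G : Type*} [NormedAddCommGroup E]
    [NormedSpace ℝ E] [NormedAddCommGroup G] [NormedSpace ℝ G] {f : E → G} {x : E} {c : ℝ}
    (h : ∀ v, ‖f v‖ ≤ c * ‖v - x‖ ^ 2) : HasFDerivAt f (0 : E →L[ℝ] G) x :=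
  (Asymptotics.IsBigO.of_bound c (Eventually.of_forall fun v => by
    simpa only [norm_pow, norm_norm] using h v)).hasFDerivAt one_lt_two

/-- A `C¹` approximation of the positive part `u⁺`, within `ε` of it. -/
noncomputable def softPosPart (ε u : ℝ) : ℝ :=
  u⁺ ^ 2 / (u⁺ + ε)

/-- The derivative of `softPosPart ε`. -/
noncomputable def softPosPartDeriv (ε u : ℝ) : ℝ :=
  1 - (ε / (u⁺ + ε)) ^ 2

section softPosPart

variable {ε u : ℝ}

theorem softPosPart_of_nonpos (hu : u ≤ 0) : softPosPart ε u = 0 := by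
  simp [softPosPart, posPart_eq_zero.2 hu]

theorem softPosPart_nonneg (hε : 0 ≤ ε) : 0 ≤ softPosPart ε u := by
  have := posPart_nonneg u
  unfold softPosPart
  positivity

theorem softPosPart_le_posPart (hε : 0 < ε) : softPosPart ε u ≤ u⁺ := by
  have := posPart_nonneg u
  rw [softPosPart, div_le_iff₀ (by positivity)]
  nlinarith

theorem sub_le_softPosPart (hε : 0 < ε) : u - ε ≤ softPosPart ε u := by
  have := posPart_nonneg u
  have := le_posPart u
  rw [softPosPart, le_div_iff₀ (by positivity)]
  nlinarith

theorem softPosPartDeriv_of_nonpos (hε : ε ≠ 0) (hu : u ≤ 0) : softPosPartDeriv ε u = 0 := by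
  simp [softPosPartDeriv, posPart_eq_zero.2 hu, hε]

theorem softPosPartDeriv_mem_Icc (hε : 0 < ε) : softPosPartDeriv ε u ∈ Icc 0 1 := by
  have hu := posPart_nonneg u
  have hratio : ε / (u⁺ + ε) ≤ 1 := (div_le_one (by positivity)).2 (by linarith)
  have hratio_nonneg : 0 ≤ ε / (u⁺ + ε) := by positivity
  exact ⟨sub_nonneg.2 (pow_le_one₀ hratio_nonneg hratio), sub_le_self _ (sq_nonneg _)⟩

theorem hasDerivAt_softPosPart (hε : 0 < ε) (u : ℝ) :
    HasDerivAt (softPosPart ε) (softPosPartDeriv ε u) u := by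
  have hright {v : ℝ} (hv : 0 ≤ v) :
      HasDerivAt (fun w => w ^ 2 / (w + ε)) (softPosPartDeriv ε v) v := by
    have hne : v + ε ≠ 0 := by positivity
    refine ((hasDerivAt_pow 2 v).div ((hasDerivAt_id v).add_const ε) hne).congr_deriv ?_
    rw [softPosPartDeriv, posPart_eq_self.2 hv]
    simp only [id_eq]
    field_simp
    push_cast
    ring
  rcases le_or_gt u 0 with hu | hu
  · have hle (v : ℝ) : ‖softPosPart ε v‖ ≤ ε⁻¹ * ‖v - u‖ ^ 2 := by
      have hpos : v⁺ ≤ ‖v - u‖ :=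
        sup_le ((le_sub_self_iff v |>.2 hu).trans (le_abs_self _)) (norm_nonneg _)
      have := posPart_nonneg v
      rw [Real.norm_of_nonneg (softPosPart_nonneg hε.le), softPosPart, mul_comm, ← div_eq_mul_inv]
      gcongr
      linarith
    rw [softPosPartDeriv_of_nonpos hε.ne' hu]
    exact (hasFDerivAt_zero_of_norm_le_norm_sub_sq hle).hasDerivAt
  · refine (hright hu.le).congr_of_eventuallyEq ?_
    filter_upwards [Ioi_mem_nhds hu] with v hv
    rw [softPosPart, posPart_eq_self.2 (mem_Ioi.1 hv).le]

end softPosPart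

section softSupport

variable {E : Type*} [NormedAddCommGroup E] [InnerProductSpace ℝ E]

/-- The log-sum-exp approximation, with inverse temperature `β`, of the support function
`y ↦ max_{q ∈ F} ⟪q, y⟫` of a finite set. -/
noncomputable def softSupport (F : Finset E) (β : ℝ) (y : E) : ℝ :=
  β⁻¹ * Real.log (∑ q ∈ F, Real.exp (β * ⟪q, y⟫))

variable {F : Finset E} {β : ℝ}

theorem softSupport_zero : softSupport F β 0 = β⁻¹ * Real.log F.card := by
  simp [softSupport]

theorem inner_le_softSupport (hβ : 0 < β) {q : E} (hq : q ∈ F) (y : E) :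
    ⟪q, y⟫ ≤ softSupport F β y := by
  rw [softSupport, le_inv_mul_iff₀ hβ,
    Real.le_log_iff_exp_le (Finset.sum_pos (fun _ _ => Real.exp_pos _) ⟨q, hq⟩)]
  exact Finset.single_le_sum (f := fun q => Real.exp (β * ⟪q, y⟫))
    (fun _ _ => (Real.exp_pos _).le) hq

theorem hasGradientAt_softSupport [CompleteSpace E] (hF : F.Nonempty) (hβ : β ≠ 0) (y : E) :
    HasGradientAt (softSupport F β) (F.centerMass (fun q => Real.exp (β * ⟪q, y⟫)) id) y := by
  have hsum : ∑ q ∈ F, Real.exp (β * ⟪q, y⟫) ≠ 0 :=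
    (Finset.sum_pos (fun _ _ => Real.exp_pos _) hF).ne'
  have hexp (q : E) : HasFDerivAt (fun y : E => Real.exp (β * ⟪q, y⟫))
      (Real.exp (β * ⟪q, y⟫) • (β • innerSL ℝ q)) y :=
    (((innerSL ℝ q).hasFDerivAt (x := y)).const_mul β).exp
  rw [hasGradientAt_iff_hasFDerivAt]
  refine (((HasFDerivAt.fun_sum fun q _ => hexp q).log hsum).const_mul β⁻¹).congr_fderiv ?_
  ext v
  simp only [Finset.centerMass, id, smul_apply, sum_apply, innerSL_apply_apply, smul_eq_mul,
    InnerProductSpace.toDual_apply_apply, sum_inner, inner_smul_left, conj_trivial]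
  rw [mul_left_comm, Finset.mul_sum]
  exact congrArg _ (Finset.sum_congr rfl fun q _ => by field_simp)

theorem centerMass_exp_mem_convexHull (hF : F.Nonempty) (w : E → ℝ) :
    F.centerMass (fun q => Real.exp (w q)) id ∈ convexHull ℝ (F : Set E) :=
  F.centerMass_mem_convexHull (fun _ _ => (Real.exp_pos _).le)
    (Finset.sum_pos (fun _ _ => Real.exp_pos _) hF) fun _ hq => hq

theorem exists_smooth_supportFunction [CompleteSpace E] (hF : F.Nonempty) {ε : ℝ} (hε : 0 < ε) :
    ∃ g : E → ℝ, (∀ y, ∃ z ∈ convexHull ℝ (F : Set E), HasGradientAt g z y) ∧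
      (∀ q ∈ F, ∀ y, ⟪q, y⟫ ≤ g y) ∧ g 0 ≤ ε := by
  have : 0 ≤ Real.log F.card := Real.log_natCast_nonneg _
  have hβ : 0 < (Real.log F.card + 1) / ε := by positivity
  refine ⟨softSupport F _, fun y => ⟨_, centerMass_exp_mem_convexHull hF _,
    hasGradientAt_softSupport hF hβ.ne' y⟩, fun q hq => inner_le_softSupport hβ hq, ?_⟩
  rw [softSupport_zero, inv_mul_le_iff₀ hβ, div_mul_cancel₀ _ hε.ne']
  exact le_add_of_nonneg_right zero_le_one

end softSupport

theorem exists_gradient_eq_of_forall_diff_lt {E : Type*} [NormedAddCommGroup E]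
    [InnerProductSpace ℝ E] [CompleteSpace E] {f : E → ℝ} (hf : Differentiable ℝ f) {s t : Set E}
    (ht : IsCompact t) (hs : IsOpen s) (hst : s ⊆ t) {q z : E} (hz : z ∈ t)
    (hlt : ∀ y ∈ t \ s, f z - ⟪q, z⟫ < f y - ⟪q, y⟫) : ∃ y ∈ s, ∇ f y = q := by
  have hderiv (y : E) := (hf y).hasFDerivAt.fun_sub ((innerSL ℝ q).hasFDerivAt (x := y))
  obtain ⟨y, hy, hmin⟩ := ht.exists_isLocalMin_mem_open hst
    (fun y _ => (hderiv y).continuousAt.continuousWithinAt) hz hlt hs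
  have hfderiv : fderiv ℝ f y = innerSL ℝ q := sub_eq_zero.1 (hmin.hasFDerivAt_eq_zero (hderiv y))
  exact ⟨y, hy, (hasGradientAt_iff_hasFDerivAt.2 (hfderiv ▸ (hf y).hasFDerivAt)).gradient⟩

theorem smul_add_smul_mem_cthickening {E : Type*} [NormedAddCommGroup E] [NormedSpace ℝ E]
    {s : Set E} (hs : Convex ℝ s) (h0 : 0 ∈ s) {y z : E} (hz : z ∈ s) {c r : ℝ} (hc : 0 ≤ c)
    (hy : ‖y‖ ≤ r) {θ : ℝ} (hθ : θ ∈ Icc 0 1) :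
    θ • (z + c • y) ∈ cthickening (c * r) s := by
  refine mem_cthickening_of_dist_le _ (θ • z) _ _ (hs.smul_mem_of_zero_mem h0 hz hθ) ?_
  rw [smul_add, dist_self_add_left, norm_smul, norm_smul, Real.norm_of_nonneg hθ.1,
    Real.norm_of_nonneg hc]
  exact (mul_le_of_le_one_left (by positivity) hθ.2).trans (by gcongr)

section cutBump

variable {E : Type*} [NormedAddCommGroup E]

/-- A smooth version of `min (0, g - c (r² - ‖·‖²))`: the graph of `g` pushed below zero near the
origin and cut off at height zero. -/
noncomputable def cutBump (g : E → ℝ) (c r ε : ℝ) (y : E) : ℝ :=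
  -softPosPart ε (c * (r ^ 2 - ‖y‖ ^ 2) - g y)

variable {g : E → ℝ} {c r ε : ℝ}

theorem support_cutBump_subset (hg : ∀ y, 0 ≤ g y) (hc : 0 ≤ c) (hr : 0 ≤ r) :
    Function.support (cutBump g c r ε) ⊆ closedBall 0 r := by
  intro y hy
  rw [mem_closedBall_zero_iff]
  by_contra! hlt
  have : r ^ 2 ≤ ‖y‖ ^ 2 := by gcongr
  refine hy (neg_eq_zero.2 (softPosPart_of_nonpos ?_))
  nlinarith [hg y]

theorem abs_cutBump_le (hg : ∀ y, 0 ≤ g y) (hc : 0 ≤ c) (hε : 0 < ε) (y : E) :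
    |cutBump g c r ε y| ≤ c * r ^ 2 := by
  rw [cutBump, abs_neg, abs_of_nonneg (softPosPart_nonneg hε.le)]
  refine (softPosPart_le_posPart hε).trans (sup_le ?_ (by positivity))
  nlinarith [hg y, sq_nonneg ‖y‖]

variable [InnerProductSpace ℝ E]

theorem hasGradientAt_cutBump [CompleteSpace E] (hε : 0 < ε) {y z : E} (hg : HasGradientAt g z y) :
    HasGradientAt (cutBump g c r ε)
      (softPosPartDeriv ε (c * (r ^ 2 - ‖y‖ ^ 2) - g y) • (z + (2 * c) • y)) y := by
  rw [hasGradientAt_iff_hasFDerivAt] at hg ⊢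
  have hinner := (((hasStrictFDerivAt_norm_sq y).hasFDerivAt.const_sub (r ^ 2)).const_mul c).fun_sub
    hg
  refine ((hasDerivAt_softPosPart hε _).comp_hasFDerivAt y hinner).neg.congr_fderiv ?_
  ext v
  simp only [smul_apply, sub_apply, neg_apply, InnerProductSpace.toDual_apply_apply,
    inner_smul_left, inner_add_left, conj_trivial, smul_eq_mul, nsmul_eq_mul, innerSL_apply_apply]
  push_cast
  ring

theorem gradient_cutBump_mem_cthickening [CompleteSpace E] (hc : 0 ≤ c) (hr : 0 ≤ r) (hε : 0 < ε)
    {y z : E} (hg : HasGradientAt g z y) (hgy : 0 ≤ g y) {s : Set E} (hs : Convex ℝ s)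
    (h0 : 0 ∈ s) (hz : z ∈ s) : ∇ (cutBump g c r ε) y ∈ cthickening (2 * c * r) s := by
  rw [(hasGradientAt_cutBump hε hg).gradient]
  rcases le_or_gt ‖y‖ r with hy | hy
  · exact smul_add_smul_mem_cthickening hs h0 hz (by positivity) hy (softPosPartDeriv_mem_Icc hε)
  · have : r ^ 2 ≤ ‖y‖ ^ 2 := by gcongr
    rw [softPosPartDeriv_of_nonpos hε.ne' (by nlinarith), zero_smul]
    exact self_subset_cthickening s h0

theorem exists_gradient_cutBump_eq_smul [ProperSpace E] (hg : Differentiable ℝ g)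
    (hg_nonneg : ∀ y, 0 ≤ g y) (hc : 0 < c) (hr : 0 < r) (hε : 0 < ε) (hg0 : g 0 ≤ ε)
    {q : E} (hq : ∀ y, ⟪q, y⟫ ≤ g y) {a : ℝ} (ha : 0 ≤ a)
    (hεa : 2 * ε < (1 - a) * (c * r ^ 2)) :
    ∃ y ∈ closedBall 0 r, ∇ (cutBump g c r ε) y = a • q := by
  let u : E → ℝ := fun y => c * (r ^ 2 - ‖y‖ ^ 2) - g y
  have hu : Continuous u := by have := hg.continuous; fun_prop
  have hcr : 0 < c * r ^ 2 := by positivity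
  have hu_ball : {y | 0 ≤ u y} ⊆ closedBall 0 r := fun y (hy : 0 ≤ u y) => by
    have : ‖y‖ ^ 2 ≤ r ^ 2 := by nlinarith [hg_nonneg y]
    exact mem_closedBall_zero_iff.2 ((sq_le_sq₀ (norm_nonneg y) hr.le).1 this)
  have hu_compact : IsCompact {y | 0 ≤ u y} :=
    (isCompact_closedBall 0 r).of_isClosed_subset (isClosed_le continuous_const hu) hu_ball
  have hu_zero : 0 ≤ u 0 := by
    simp only [u, norm_zero]
    nlinarith
  have hlow : cutBump g c r ε 0 - ⟪a • q, 0⟫ < -(a * (c * r ^ 2)) := by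
    have := sub_le_softPosPart (u := u 0) hε
    simp only [cutBump, u, norm_zero, inner_zero_right] at this ⊢
    linarith
  have hhigh (y : E) (hy : u y = 0) : -(a * (c * r ^ 2)) ≤ cutBump g c r ε y - ⟪a • q, y⟫ := by
    have hqy : ⟪q, y⟫ ≤ c * r ^ 2 := (hq y).trans (by nlinarith [sq_nonneg ‖y‖])
    rw [show cutBump g c r ε y = 0 from neg_eq_zero.2 (softPosPart_of_nonpos hy.le),
      real_inner_smul_left]
    nlinarith
  -- `cutBump - ⟪a • q, ·⟫` is smaller at the origin than on `{u = 0}`, so it has a minimum inside.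
  obtain ⟨y, hy, hgrad⟩ := exists_gradient_eq_of_forall_diff_lt
    (fun y => (hasGradientAt_cutBump hε (hg y).hasGradientAt).differentiableAt) hu_compact
    (isOpen_lt continuous_const hu) (fun _ (hy : 0 < u _) => hy.le) hu_zero
    fun y hy => hlow.trans_le (hhigh y (le_antisymm (not_lt.1 hy.2) hy.1))
  exact ⟨y, hu_ball (show 0 < u y from hy).le, hgrad⟩

end cutBump

section IsGradientBump

variable {E : Type*} [NormedAddCommGroup E] [InnerProductSpace ℝ E]

/-- A differentiable function bounded by `η * r` and supported in `closedBall c r` whose gradients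
lie within `η` of the convex hull of `F` and come within `η` of every point of `F`. -/
structure IsGradientBump [CompleteSpace E] (F : Set E) (c : E) (r η : ℝ) (b : E → ℝ) : Prop where
  differentiable : Differentiable ℝ b
  support_subset : Function.support b ⊆ closedBall c r
  abs_le (y : E) : |b y| ≤ η * r
  gradient_mem (y : E) : ∇ b y ∈ cthickening η (convexHull ℝ F)
  exists_dist_gradient_le {q : E} (hq : q ∈ F) : ∃ y ∈ closedBall c r, dist (∇ b y) q ≤ η

theorem gradient_comp_sub [CompleteSpace E] (b : E → ℝ) (c y : E) :
    ∇ (fun z => b (z - c)) y = ∇ b (y - c) := by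
  rw [gradient, gradient, fderiv_comp_sub]

theorem IsGradientBump.comp_sub [CompleteSpace E] {F : Set E} {r η : ℝ} {b : E → ℝ}
    (hb : IsGradientBump F 0 r η b) (c : E) : IsGradientBump F c r η fun y => b (y - c) where
  differentiable := hb.differentiable.comp (differentiable_id.sub_const c)
  support_subset y hy := by
    simpa [dist_eq_norm] using hb.support_subset hy
  abs_le y := hb.abs_le (y - c)
  gradient_mem y := gradient_comp_sub b c y ▸ hb.gradient_mem (y - c)
  exists_dist_gradient_le hq := by
    obtain ⟨y, hy, hyq⟩ := hb.exists_dist_gradient_le hq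
    refine ⟨y + c, by simpa [dist_eq_norm] using hy, ?_⟩
    rwa [gradient_comp_sub, add_sub_cancel_right]

theorem dist_smul_self_le_of_norm_le {q : E} {R η : ℝ} (hq : ‖q‖ ≤ R) (hR : 0 ≤ R) (hη : 0 < η) :
    dist ((R / (R + η)) • q) q ≤ η := by
  have hsub : R / (R + η) - 1 = -(η / (R + η)) := by field_simp; ring
  have hsmul : (R / (R + η)) • q - q = (-(η / (R + η))) • q := by rw [← hsub, sub_smul, one_smul]
  rw [dist_eq_norm, hsmul, norm_smul, norm_neg, Real.norm_of_nonneg (by positivity)]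
  calc η / (R + η) * ‖q‖ ≤ η / (R + η) * R := by gcongr
    _ ≤ η := by rw [div_mul_eq_mul_div, div_le_iff₀ (by positivity)]; nlinarith

theorem exists_isGradientBump [ProperSpace E] {F : Set E} (hF : F.Finite) (h0 : 0 ∈ F) (c : E)
    {r η : ℝ} (hr : 0 < r) (hη : 0 < η) : ∃ b, IsGradientBump F c r η b := by
  suffices ∃ b, IsGradientBump F 0 r η b from this.imp' _ fun _ hb => hb.comp_sub c
  obtain ⟨R, hR, hFR⟩ := hF.isBounded.exists_pos_norm_le
  lift F to Finset E using hF
  let κ := η / (2 * r)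
  let a := R / (R + η)
  have hκ : 0 < κ := by positivity
  have ha : 0 < 1 - a := sub_pos.2 ((div_lt_one (by positivity)).2 (by linarith))
  let ε := (1 - a) * (κ * r ^ 2) / 4
  have hε : 0 < ε := by positivity
  have hεa : 2 * ε < (1 - a) * (κ * r ^ 2) := by simp only [ε] at hε ⊢; linarith
  obtain ⟨g, hg, hFg, hg0⟩ := exists_smooth_supportFunction ⟨0, h0⟩ hε
  have hg_nonneg (y : E) : 0 ≤ g y := by simpa using hFg 0 h0 y
  have hg_diff : Differentiable ℝ g := fun y => (hg y).elim fun _ h => h.2.differentiableAt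
  have hb {y z : E} (hz : HasGradientAt g z y) := hasGradientAt_cutBump (c := κ) (r := r) hε hz
  refine ⟨cutBump g κ r ε, fun y => (hb (hg_diff y).hasGradientAt).differentiableAt,
    support_cutBump_subset hg_nonneg hκ.le hr.le, fun y => ?_, fun y => ?_, fun {q} hq => ?_⟩
  · refine (abs_cutBump_le hg_nonneg hκ.le hε y).trans ?_
    simp only [κ]
    field_simp
    norm_num
  · obtain ⟨z, hz, hgz⟩ := hg y
    have hκr : 2 * κ * r = η := by simp only [κ]; field_simp
    exact hκr ▸ gradient_cutBump_mem_cthickening hκ.le hr.le hε hgz (hg_nonneg y)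
      (convex_convexHull ℝ _) (subset_convexHull ℝ _ h0) hz
  · obtain ⟨y, hy, hgrad⟩ := exists_gradient_cutBump_eq_smul hg_diff hg_nonneg hκ hr hε hg0
      (hFg q hq) (a := a) (by positivity) hεa
    exact ⟨y, hy, hgrad ▸ dist_smul_self_le_of_norm_le (hFR q hq) hR.le hη⟩

end IsGradientBump

section tsum

variable {ι α M : Type*} [AddCommMonoid M] [TopologicalSpace M] {b : ι → α → M} {S : ι → Set α}

theorem tsum_apply_eq_zero_of_forall_notMem (hsupp : ∀ k, Function.support (b k) ⊆ S k) {y : α}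
    (hy : ∀ k, y ∉ S k) : ∑' k, b k y = 0 := by
  have hzero (k : ι) : b k y = 0 := Function.notMem_support.1 fun h => hy k (hsupp k h)
  simp only [hzero, tsum_zero]

theorem tsum_apply_eq_of_mem (hsupp : ∀ k, Function.support (b k) ⊆ S k)
    (hdisj : Pairwise (Function.onFun Disjoint S)) {k : ι} {y : α} (hy : y ∈ S k) :
    ∑' j, b j y = b k y :=
  tsum_eq_single k fun _ hj => Function.notMem_support.1 fun h =>
    (hdisj hj).le_bot ⟨hsupp _ h, hy⟩

end tsum

section gradient_tsum

variable {ι E : Type*} [NormedAddCommGroup E] [InnerProductSpace ℝ E] [CompleteSpace E]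
  {b : ι → E → ℝ} {S : ι → Set E} {y : E}

theorem hasGradientAt_tsum_of_mem (hsupp : ∀ k, Function.support (b k) ⊆ S k)
    (hdisj : Pairwise (Function.onFun Disjoint S)) (hloc : ∀ᶠ v in 𝓝 y, ∀ k, v ∈ S k → y ∈ S k)
    {k : ι} (hb : DifferentiableAt ℝ (b k) y) (hy : y ∈ S k) :
    HasGradientAt (fun v => ∑' j, b j v) (∇ (b k) y) y := by
  refine hb.hasGradientAt.congr_of_eventuallyEq (hloc.mono fun v hv => ?_)
  by_cases hvk : v ∈ S k
  · exact tsum_apply_eq_of_mem hsupp hdisj hvk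
  · have hvS (j : ι) (hj : v ∈ S j) : False := by
      obtain rfl : j = k := by_contra fun hne => (hdisj hne).le_bot ⟨hv j hj, hy⟩
      exact hvk hj
    exact (tsum_apply_eq_zero_of_forall_notMem hsupp hvS).trans
      (Function.notMem_support.1 fun hv => hvk (hsupp k hv)).symm

theorem hasGradientAt_tsum_zero_of_forall_notMem (hsupp : ∀ k, Function.support (b k) ⊆ S k)
    (hloc : ∀ᶠ v in 𝓝 y, ∀ k, v ∈ S k → y ∈ S k) (hy : ∀ k, y ∉ S k) :
    HasGradientAt (fun v => ∑' j, b j v) 0 y :=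
  (hasGradientAt_const y (0 : ℝ)).congr_of_eventuallyEq <| hloc.mono fun _ hv =>
    tsum_apply_eq_zero_of_forall_notMem hsupp fun k hk => hy k (hv k hk)

theorem hasGradientAt_tsum_zero_of_abs_le (hsupp : ∀ k, Function.support (b k) ⊆ S k)
    (hdisj : Pairwise (Function.onFun Disjoint S)) {c : ℝ} (hc : 0 ≤ c)
    (hle : ∀ k, ∀ v ∈ S k, |b k v| ≤ c * ‖v - y‖ ^ 2) :
    HasGradientAt (fun v => ∑' j, b j v) 0 y := by
  rw [hasGradientAt_iff_hasFDerivAt, map_zero]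
  refine hasFDerivAt_zero_of_norm_le_norm_sub_sq (c := c) fun v => ?_
  by_cases hv : ∃ k, v ∈ S k
  · obtain ⟨k, hk⟩ := hv
    exact tsum_apply_eq_of_mem hsupp hdisj hk ▸ hle k v hk
  · rw [tsum_apply_eq_zero_of_forall_notMem hsupp (not_exists.1 hv), norm_zero]
    positivity

end gradient_tsum

section dyadicBall

variable {E : Type*} [NormedAddCommGroup E] [InnerProductSpace ℝ E]

/-- The point with coordinates `(t k, 2⁻ᵏ)` in the plane of the orthonormal vectors `e₁`, `e₂`. -/
noncomputable def dyadicCenter (e₁ e₂ : E) (t : ℕ → ℝ) (k : ℕ) : E :=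
  t k • e₁ + (1 / 2 : ℝ) ^ k • e₂

/-- The supports of the bumps. These disjoint balls accumulate only on the line `ℝ e₁`, at the
points `x • e₁` with `x` a cluster point of `t`. -/
def dyadicBall (e₁ e₂ : E) (t : ℕ → ℝ) (k : ℕ) : Set E :=
  closedBall (dyadicCenter e₁ e₂ t k) ((1 / 2) ^ k / 4)

variable {e₁ e₂ : E} {t : ℕ → ℝ} {k : ℕ} {x : ℝ} {y : E}

theorem inner_mem_Icc_of_mem_dyadicBall (h₂ : ‖e₂‖ = 1) (h : ⟪e₂, e₁⟫ = 0)
    (hy : y ∈ dyadicBall e₁ e₂ t k) :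
    ⟪e₂, y⟫ ∈ Icc (3 / 4 * (1 / 2) ^ k) (5 / 4 * (1 / 2) ^ k) := by
  have hinner : ⟪e₂, y - dyadicCenter e₁ e₂ t k⟫ = ⟪e₂, y⟫ - (1 / 2) ^ k := by
    simp only [dyadicCenter, inner_sub_right, inner_add_right, real_inner_smul_right, h,
      real_inner_self_eq_norm_sq, h₂]
    ring
  have hle := hinner ▸ abs_real_inner_le_norm e₂ (y - dyadicCenter e₁ e₂ t k)
  rw [h₂, one_mul, ← dist_eq_norm] at hle
  have := abs_le.1 (hle.trans hy)
  constructor <;> linarith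

theorem pairwise_disjoint_dyadicBall (h₂ : ‖e₂‖ = 1) (h : ⟪e₂, e₁⟫ = 0) :
    Pairwise (Function.onFun Disjoint (dyadicBall e₁ e₂ t)) := by
  refine (pairwise_disjoint_on _).2 fun j k hjk => ?_
  refine disjoint_left.2 fun y hj hk => ?_
  have hlow := (inner_mem_Icc_of_mem_dyadicBall h₂ h hj).1
  have hhigh := (inner_mem_Icc_of_mem_dyadicBall h₂ h hk).2
  have hpow : (1 / 2 : ℝ) ^ k ≤ (1 / 2) ^ (j + 1) :=
    pow_le_pow_of_le_one (by norm_num) (by norm_num) hjk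
  rw [pow_succ] at hpow
  linarith [show (0 : ℝ) < (1 / 2) ^ j by positivity]

theorem dyadicBall_subset_closedBall (h₁ : ‖e₁‖ = 1) (h₂ : ‖e₂‖ = 1) (k : ℕ) (x : ℝ) :
    dyadicBall e₁ e₂ t k ⊆ closedBall (x • e₁) (|t k - x| + 2 * (1 / 2) ^ k) := by
  refine closedBall_subset_closedBall' ?_
  have hpow : (0 : ℝ) < (1 / 2) ^ k := by positivity
  rw [dyadicCenter, dist_eq_norm, add_sub_right_comm, ← sub_smul]
  refine (add_le_add_right (norm_add_le _ _) _).trans ?_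
  rw [norm_smul, norm_smul, h₁, h₂, Real.norm_eq_abs, Real.norm_of_nonneg hpow.le]
  linarith

theorem dyadicBall_subset_closedBall_zero (h₁ : ‖e₁‖ = 1) (h₂ : ‖e₂‖ = 1) (ht : t k ∈ Icc 0 1) :
    dyadicBall e₁ e₂ t k ⊆ closedBall 0 3 := by
  have hsub := dyadicBall_subset_closedBall (t := t) h₁ h₂ k 0
  rw [zero_smul, sub_zero, abs_of_nonneg ht.1] at hsub
  have hpow : (1 / 2 : ℝ) ^ k ≤ 1 := pow_le_one₀ one_half_pos.le one_half_lt_one.le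
  exact hsub.trans (closedBall_subset_closedBall (by linarith [ht.2]))

theorem inner_le_dist_smul (h₂ : ‖e₂‖ = 1) (h : ⟪e₂, e₁⟫ = 0) (x : ℝ) (y : E) :
    ⟪e₂, y⟫ ≤ dist y (x • e₁) := by
  calc ⟪e₂, y⟫ = ⟪e₂, y - x • e₁⟫ := by rw [inner_sub_right, real_inner_smul_right, h]; ring
    _ ≤ ‖e₂‖ * ‖y - x • e₁‖ := real_inner_le_norm _ _
    _ = dist y (x • e₁) := by rw [h₂, one_mul, dist_eq_norm]

theorem eventually_forall_mem_dyadicBall_imp_mem_dyadicBall (h₂ : ‖e₂‖ = 1) (h : ⟪e₂, e₁⟫ = 0)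
    (hy : 0 < ⟪e₂, y⟫) :
    ∀ᶠ v in 𝓝 y, ∀ k, v ∈ dyadicBall e₁ e₂ t k → y ∈ dyadicBall e₁ e₂ t k := by
  obtain ⟨n, hn⟩ := exists_pow_lt_of_lt_one (half_pos hy) (one_half_lt_one (α := ℝ))
  have hlt : ∀ᶠ v in 𝓝 y, 2 * (1 / 2) ^ n < ⟪e₂, v⟫ :=
    ((innerSL ℝ e₂).continuous.tendsto y).eventually_const_lt
      ((lt_div_iff₀' two_pos).1 hn)
  have hfin : ∀ᶠ v in 𝓝 y, ∀ k ∈ Iio n, v ∈ dyadicBall e₁ e₂ t k → y ∈ dyadicBall e₁ e₂ t k := by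
    refine (eventually_all_finite (finite_Iio n)).2 fun k _ => ?_
    by_cases hyk : y ∈ dyadicBall e₁ e₂ t k
    · exact Eventually.of_forall fun _ _ => hyk
    · exact (isClosed_closedBall.isOpen_compl.eventually_mem hyk).mono fun v hv hvk => (hv hvk).elim
  filter_upwards [hlt, hfin] with v hv hvfin k hk
  refine hvfin k (mem_Iio.2 ?_) hk
  by_contra! hnk
  have hpow : (1 / 2 : ℝ) ^ k ≤ (1 / 2) ^ n :=
    pow_le_pow_of_le_one (by norm_num) (by norm_num) hnk
  linarith [(inner_mem_Icc_of_mem_dyadicBall h₂ h hk).2, show (0 : ℝ) < (1 / 2) ^ k by positivity]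

theorem pow_le_dist_of_mem_dyadicBall (h₂ : ‖e₂‖ = 1) (h : ⟪e₂, e₁⟫ = 0)
    (hy : y ∈ dyadicBall e₁ e₂ t k) (x : ℝ) : (1 / 2) ^ k ≤ 2 * dist y (x • e₁) := by
  linarith [(inner_mem_Icc_of_mem_dyadicBall h₂ h hy).1, inner_le_dist_smul h₂ h x y,
    show (0 : ℝ) < (1 / 2) ^ k by positivity]

theorem abs_sub_le_dist_of_mem_dyadicBall (h₁ : ‖e₁‖ = 1) (h₂ : ‖e₂‖ = 1) (h : ⟪e₂, e₁⟫ = 0)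
    (hy : y ∈ dyadicBall e₁ e₂ t k) (x : ℝ) : |t k - x| ≤ 5 * dist y (x • e₁) := by
  have hdist : dist (t k • e₁) (x • e₁) = |t k - x| := by
    rw [dist_eq_norm, ← sub_smul, norm_smul, h₁, mul_one, Real.norm_eq_abs]
  have hball : dist y (t k • e₁) ≤ 2 * (1 / 2) ^ k := by
    simpa using dyadicBall_subset_closedBall h₁ h₂ k (t k) hy
  have htri := dist_triangle_left (t k • e₁) (x • e₁) y
  linarith [pow_le_dist_of_mem_dyadicBall h₂ h hy x]

theorem eventually_forall_mem_dyadicBall_imp_mem (h₁ : ‖e₁‖ = 1) (h₂ : ‖e₂‖ = 1) (h : ⟪e₂, e₁⟫ = 0)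
    {T : Set ℕ} (hT : T ∈ atTop ⊓ comap t (𝓝 x)) :
    ∀ᶠ y in 𝓝 (x • e₁), ∀ k, y ∈ dyadicBall e₁ e₂ t k → k ∈ T := by
  obtain ⟨⟨n, δ⟩, ⟨-, hδ⟩, hsub⟩ := (atTop_basis.inf (nhds_basis_ball.comap t)).mem_iff.1 hT
  have hpow : (0 : ℝ) < (1 / 2) ^ n / 2 := by positivity
  have hδ5 : 0 < δ / 5 := by positivity
  filter_upwards [ball_mem_nhds (x • e₁) hpow, ball_mem_nhds (x • e₁) hδ5] with y hyn hyδ k hk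
  rw [mem_ball] at hyn hyδ
  refine hsub ⟨?_, ?_⟩
  · exact ((pow_lt_pow_iff_right_of_lt_one₀ one_half_pos (one_half_lt_one (α := ℝ))).1
      (by linarith [pow_le_dist_of_mem_dyadicBall h₂ h hk x])).le
  · exact mem_ball.2 (by
      linarith [abs_sub_le_dist_of_mem_dyadicBall h₁ h₂ h hk x, Real.dist_eq (t k) x])

theorem tendsto_dyadicBall_smallSets (h₁ : ‖e₁‖ = 1) (h₂ : ‖e₂‖ = 1) (x : ℝ) :
    Tendsto (dyadicBall e₁ e₂ t) (atTop ⊓ comap t (𝓝 x)) (𝓝 (x • e₁)).smallSets := by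
  have hdist : Tendsto (fun k => |t k - x|) (atTop ⊓ comap t (𝓝 x)) (𝓝 0) :=
    tendsto_iff_dist_tendsto_zero.1 (tendsto_comap.mono_left inf_le_right)
  have hpow : Tendsto (fun k : ℕ => 2 * (1 / 2 : ℝ) ^ k) (atTop ⊓ comap t (𝓝 x)) (𝓝 0) := by
    simpa using ((tendsto_pow_atTop_nhds_zero_of_lt_one one_half_pos.le
      (one_half_lt_one (α := ℝ))).const_mul 2).mono_left inf_le_left
  have hball := (tendsto_closedBall_smallSets (x • e₁)).comp
    (add_zero (0 : ℝ) ▸ hdist.add hpow)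
  exact tendsto_smallSets_iff.2 fun U hU => ((tendsto_smallSets_iff.1 hball U hU).mono
    fun k hk => (dyadicBall_subset_closedBall h₁ h₂ k x).trans hk)

theorem sq_le_norm_sub_sq_of_mem_dyadicBall (h₂ : ‖e₂‖ = 1) (h : ⟪e₂, e₁⟫ = 0)
    (hy : ⟪e₂, y⟫ ≤ 0) {v : E} (hv : v ∈ dyadicBall e₁ e₂ t k) :
    (1 / 2) ^ k * ((1 / 2) ^ k / 4) ≤ ‖v - y‖ ^ 2 := by
  have hle : ⟪e₂, v - y⟫ ≤ ‖v - y‖ := by simpa [h₂] using real_inner_le_norm e₂ (v - y)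
  rw [inner_sub_right] at hle
  have hlow := (inner_mem_Icc_of_mem_dyadicBall h₂ h hv).1
  have hpow : (0 : ℝ) < (1 / 2) ^ k := by positivity
  calc (1 / 2) ^ k * ((1 / 2) ^ k / 4) = ((1 / 2 : ℝ) ^ k / 2) ^ 2 := by ring
    _ ≤ ‖v - y‖ ^ 2 := by gcongr; linarith

end dyadicBall

section clusterPoints

variable {ι X : Type*} [TopologicalSpace X] {p : X} {S : ι → Set X} {η : ι → ℝ} {l : Filter ι}

theorem mapClusterPt_of_forall_exists_dist_le {Y : Type*} [PseudoMetricSpace Y] {G : X → Y}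
    {F : ι → NonemptyCompacts Y} {K : NonemptyCompacts Y} [l.NeBot]
    (hS : Tendsto S l (𝓝 p).smallSets) (hG : ∀ k, ∀ q ∈ F k, ∃ y ∈ S k, dist (G y) q ≤ η k)
    (hF : Tendsto F l (𝓝 K)) (hη : Tendsto η l (𝓝 0)) {q : Y} (hq : q ∈ K) :
    MapClusterPt q (𝓝 p) G := by
  refine mapClusterPt_iff_frequently.2 fun V hV => frequently_iff.2 fun {U} hU => ?_
  obtain ⟨ε, hε, hεV⟩ := Metric.mem_nhds_iff.1 hV
  have hFε : ∀ᶠ k in l, ((F k : Set Y) ∩ ball q (ε / 2)).Nonempty :=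
    hF (NonemptyCompacts.isOpen_inter_nonempty_of_isOpen isOpen_ball |>.mem_nhds
      ⟨q, hq, mem_ball_self (half_pos hε)⟩)
  obtain ⟨k, hSU, ⟨z, hzF, hzq⟩, hηk⟩ := ((tendsto_smallSets_iff.1 hS U hU).and
    (hFε.and (hη.eventually_lt_const (half_pos hε)))).exists
  obtain ⟨y, hy, hyz⟩ := hG k z hzF
  refine ⟨y, hSU hy, hεV ?_⟩
  have htri := dist_triangle (G y) z q
  rw [mem_ball] at hzq ⊢
  linarith

theorem mem_of_mapClusterPt_of_forall_mem_cthickening {E : Type*} [NormedAddCommGroup E]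
    [NormedSpace ℝ E] {G : X → E} {F : ι → NonemptyCompacts E} {K : NonemptyCompacts E}
    (hK : Convex ℝ (K : Set E)) (h0 : 0 ∈ K)
    (hS : ∀ T ∈ l, ∀ᶠ y in 𝓝 p, ∀ k, y ∈ S k → k ∈ T) (hzero : ∀ y, (∀ k, y ∉ S k) → G y = 0)
    (hG : ∀ k, ∀ y ∈ S k, G y ∈ cthickening (η k) (convexHull ℝ (F k)))
    (hF : Tendsto F l (𝓝 K)) (hη : Tendsto η l (𝓝 0)) {q : E} (hq : MapClusterPt q (𝓝 p) G) :
    q ∈ K := by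
  have hcthick (ε : ℝ) (hε : 0 < ε) : q ∈ cthickening ε (K : Set E) := by
    have hFε : ∀ᶠ k in l, (F k : Set E) ⊆ thickening (ε / 2) K :=
      hF (NonemptyCompacts.isOpen_subsets_of_isOpen isOpen_thickening |>.mem_nhds
        (self_subset_thickening (half_pos hε) _))
    have hnear : ∀ᶠ k in l, ∀ y ∈ S k, G y ∈ cthickening ε (K : Set E) := by
      filter_upwards [hFε, hη.eventually_lt_const (half_pos hε)] with k hFk hηk y hy
      have hhull : convexHull ℝ (F k : Set E) ⊆ thickening (ε / 2) K :=
        convexHull_min hFk (hK.thickening _)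
      have hmem := cthickening_mono hηk.le _ (cthickening_subset_of_subset _ hhull (hG k y hy))
      simpa using cthickening_thickening_subset (half_pos hε).le _ _ hmem
    refine isClosed_cthickening.mem_of_mapClusterPt hq ((hS _ hnear).mono fun y hy => ?_)
    by_cases hyS : ∃ k, y ∈ S k
    · exact hyS.elim fun k hk => hy k hk y hk
    · exact hzero y (not_exists.1 hyS) ▸ self_subset_cthickening (K : Set E) h0
  have hclosure : q ∈ closure (K : Set E) := by
    rw [closure_eq_iInter_cthickening]
    exact mem_iInter₂.2 hcthick
  exact K.isCompact.isClosed.closure_subset hclosure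

end clusterPoints

section bumpSeries

variable {E : Type*} [NormedAddCommGroup E] [InnerProductSpace ℝ E]

section

variable [CompleteSpace E] {e₁ e₂ : E} {t : ℕ → ℝ} {F : ℕ → Set E} {η : ℕ → ℝ} {b : ℕ → E → ℝ}
  {k : ℕ} {y : E}

theorem abs_le_norm_sub_sq_of_mem_dyadicBall (h₂ : ‖e₂‖ = 1) (h : ⟪e₂, e₁⟫ = 0)
    (hη : ∀ k, η k ≤ (1 / 2) ^ k)
    (hb : ∀ k, IsGradientBump (F k) (dyadicCenter e₁ e₂ t k) ((1 / 2) ^ k / 4) (η k) (b k))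
    (hy : ⟪e₂, y⟫ ≤ 0) {v : E} (hv : v ∈ dyadicBall e₁ e₂ t k) : |b k v| ≤ 1 * ‖v - y‖ ^ 2 := by
  calc |b k v| ≤ η k * ((1 / 2) ^ k / 4) := (hb k).abs_le v
    _ ≤ (1 / 2) ^ k * ((1 / 2) ^ k / 4) := by gcongr; exact hη k
    _ ≤ 1 * ‖v - y‖ ^ 2 :=
      (sq_le_norm_sub_sq_of_mem_dyadicBall h₂ h hy hv).trans_eq (one_mul _).symm

theorem hasGradientAt_tsum_bump_of_mem (h₂ : ‖e₂‖ = 1) (h : ⟪e₂, e₁⟫ = 0)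
    (hb : ∀ k, IsGradientBump (F k) (dyadicCenter e₁ e₂ t k) ((1 / 2) ^ k / 4) (η k) (b k))
    (hy : y ∈ dyadicBall e₁ e₂ t k) : HasGradientAt (fun v => ∑' k, b k v) (∇ (b k) y) y := by
  have hpos : 0 < ⟪e₂, y⟫ :=
    lt_of_lt_of_le (by positivity) (inner_mem_Icc_of_mem_dyadicBall h₂ h hy).1
  exact hasGradientAt_tsum_of_mem (fun k => (hb k).support_subset)
    (pairwise_disjoint_dyadicBall h₂ h)
    (eventually_forall_mem_dyadicBall_imp_mem_dyadicBall h₂ h hpos) ((hb k).differentiable y) hy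

theorem hasGradientAt_tsum_bump_of_forall_notMem (h₂ : ‖e₂‖ = 1) (h : ⟪e₂, e₁⟫ = 0)
    (hη : ∀ k, η k ≤ (1 / 2) ^ k)
    (hb : ∀ k, IsGradientBump (F k) (dyadicCenter e₁ e₂ t k) ((1 / 2) ^ k / 4) (η k) (b k))
    (hy : ∀ k, y ∉ dyadicBall e₁ e₂ t k) : HasGradientAt (fun v => ∑' k, b k v) 0 y := by
  have hsupp (k : ℕ) : Function.support (b k) ⊆ dyadicBall e₁ e₂ t k := (hb k).support_subset
  rcases le_or_gt ⟪e₂, y⟫ 0 with hle | hpos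
  · exact hasGradientAt_tsum_zero_of_abs_le hsupp (pairwise_disjoint_dyadicBall h₂ h) zero_le_one
      fun _ _ => abs_le_norm_sub_sq_of_mem_dyadicBall h₂ h hη hb hle
  · exact hasGradientAt_tsum_zero_of_forall_notMem hsupp
      (eventually_forall_mem_dyadicBall_imp_mem_dyadicBall h₂ h hpos) hy

theorem setOf_mapClusterPt_gradient_tsum_bump {F : ℕ → NonemptyCompacts E} (h₁ : ‖e₁‖ = 1)
    (h₂ : ‖e₂‖ = 1) (h : ⟪e₂, e₁⟫ = 0) (hη : ∀ k, η k ∈ Ioc 0 ((1 / 2) ^ k))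
    (hb : ∀ k, IsGradientBump (F k : Set E) (dyadicCenter e₁ e₂ t k) ((1 / 2) ^ k / 4)
      (η k) (b k))
    {K : NonemptyCompacts E} (hK : Convex ℝ (K : Set E)) (h0 : 0 ∈ K) {x : ℝ}
    [(atTop ⊓ comap t (𝓝 x)).NeBot] (hF : Tendsto F (atTop ⊓ comap t (𝓝 x)) (𝓝 K)) :
    {q | MapClusterPt q (𝓝 (x • e₁)) (∇ fun v => ∑' k, b k v)} = K := by
  have hmem {k y} (hy : y ∈ dyadicBall e₁ e₂ t k) :=
    (hasGradientAt_tsum_bump_of_mem h₂ h hb hy).gradient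
  have hη_lim : Tendsto η (atTop ⊓ comap t (𝓝 x)) (𝓝 0) :=
    (squeeze_zero (fun k => (hη k).1.le) (fun k => (hη k).2)
      (tendsto_pow_atTop_nhds_zero_of_lt_one one_half_pos.le one_half_lt_one)).mono_left
      inf_le_left
  refine Subset.antisymm (fun q hq => ?_) fun q hq => ?_
  · exact mem_of_mapClusterPt_of_forall_mem_cthickening hK h0
      (fun T hT => eventually_forall_mem_dyadicBall_imp_mem h₁ h₂ h hT)
      (fun y hy =>
        (hasGradientAt_tsum_bump_of_forall_notMem h₂ h (fun k => (hη k).2) hb hy).gradient)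
      (fun k y hy => hmem hy ▸ (hb k).gradient_mem y) hF hη_lim hq
  · refine mapClusterPt_of_forall_exists_dist_le (tendsto_dyadicBall_smallSets h₁ h₂ x)
      (fun k q hqk => ?_) hF hη_lim hq
    obtain ⟨y, hy, hyq⟩ := (hb k).exists_dist_gradient_le hqk
    exact ⟨y, hy, hmem hy ▸ hyq⟩

end

theorem exists_gradient_clusterPts_eq_of_tendsto [FiniteDimensional ℝ E] {e₁ e₂ : E}
    (h₁ : ‖e₁‖ = 1) (h₂ : ‖e₂‖ = 1) (h : ⟪e₂, e₁⟫ = 0) {t : ℕ → ℝ} (ht : ∀ k, t k ∈ Icc 0 1)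
    {F : ℕ → NonemptyCompacts E} (hF : ∀ k, (F k : Set E).Finite ∧ 0 ∈ F k)
    {η : ℕ → ℝ} (hη : ∀ k, η k ∈ Ioc 0 ((1 / 2) ^ k)) :
    ∃ f : E → ℝ, Differentiable ℝ f ∧ HasCompactSupport f ∧
      (∀ y, ∃ k, ∇ f y ∈ cthickening (η k) (convexHull ℝ (F k : Set E))) ∧
      ∀ (K : NonemptyCompacts E) (x : ℝ), Convex ℝ (K : Set E) → 0 ∈ K →
        (atTop ⊓ comap t (𝓝 x)).NeBot → Tendsto F (atTop ⊓ comap t (𝓝 x)) (𝓝 K) →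
        {q | MapClusterPt q (𝓝 (x • e₁)) (∇ f)} = K := by
  choose b hb using fun k => exists_isGradientBump (hF k).1 (hF k).2
    (dyadicCenter e₁ e₂ t k) (r := (1 / 2) ^ k / 4) (by positivity) (hη k).1
  have hmem {k y} (hy : y ∈ dyadicBall e₁ e₂ t k) := hasGradientAt_tsum_bump_of_mem h₂ h hb hy
  have hnotMem {y} (hy : ∀ k, y ∉ dyadicBall e₁ e₂ t k) :=
    hasGradientAt_tsum_bump_of_forall_notMem h₂ h (fun k => (hη k).2) hb hy
  refine ⟨fun v => ∑' k, b k v, fun y => ?_, ?_, fun y => ?_, fun K x hK h0 _ hFK => ?_⟩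
  · by_cases hy : ∃ k, y ∈ dyadicBall e₁ e₂ t k
    · exact hy.elim fun k hk => (hmem hk).differentiableAt
    · exact (hnotMem (not_exists.1 hy)).differentiableAt
  · refine HasCompactSupport.intro (isCompact_closedBall 0 3) fun y hy =>
      tsum_apply_eq_zero_of_forall_notMem (fun k => (hb k).support_subset) fun k hk =>
        hy (dyadicBall_subset_closedBall_zero h₁ h₂ (ht k) hk)
  · by_cases hy : ∃ k, y ∈ dyadicBall e₁ e₂ t k
    · exact hy.imp fun k hk => (hmem hk).gradient ▸ (hb k).gradient_mem y
    · exact ⟨0, (hnotMem (not_exists.1 hy)).gradient ▸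
        self_subset_cthickening _ (subset_convexHull ℝ _ (hF 0).2)⟩
  · exact setOf_mapClusterPt_gradient_tsum_bump h₁ h₂ h hη hb hK h0 hFK

theorem exists_cthickening_convexHull_subset {F U : Set E} (hF : F.Finite) (hFU : F ⊆ U)
    (hU : IsOpen U) (hconv : Convex ℝ U) {δ : ℝ} (hδ : 0 < δ) :
    ∃ η ∈ Ioc 0 δ, cthickening η (convexHull ℝ F) ⊆ U := by
  obtain ⟨η, hη, hηU⟩ := (Set.Finite.isCompact_convexHull ℝ hF).exists_cthickening_subset_open hU
    (convexHull_min hFU hconv)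
  exact ⟨min η δ, ⟨lt_min hη hδ, min_le_right _ _⟩,
    (cthickening_mono (min_le_left _ _) _).trans hηU⟩

theorem exists_orthonormal_pair [FiniteDimensional ℝ E] (hE : 1 < Module.finrank ℝ E) :
    ∃ e₁ e₂ : E, ‖e₁‖ = 1 ∧ ‖e₂‖ = 1 ∧ ⟪e₂, e₁⟫ = 0 := by
  let e := stdOrthonormalBasis ℝ E
  exact ⟨e ⟨0, by omega⟩, e ⟨1, hE⟩, e.norm_eq_one _, e.norm_eq_one _, e.inner_eq_zero (by simp)⟩

theorem exists_gradient_clusterPts_eq [FiniteDimensional ℝ E] (hE : 1 < Module.finrank ℝ E)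
    {C : Set E} (hC : IsCompact C) (hconv : Convex ℝ C) (h0 : 0 ∈ interior C) :
    ∃ f : E → ℝ, Differentiable ℝ f ∧ HasCompactSupport f ∧ (∀ y, ∇ f y ∈ C) ∧
      ∀ K : NonemptyCompacts E, (K : Set E) ⊆ C → Convex ℝ (K : Set E) → 0 ∈ K →
        ∃ x, {q | MapClusterPt q (𝓝 x) (∇ f)} = K := by
  obtain ⟨e₁, e₂, h₁, h₂, h⟩ := exists_orthonormal_pair hE
  obtain ⟨t, F, ht, hF, hlim⟩ := exists_seq_finite_tendsto_comap hC hconv h0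
  choose η hη hηC using fun k => exists_cthickening_convexHull_subset (hF k).1 (hF k).2.2
    isOpen_interior hconv.interior (δ := (1 / 2) ^ k) (by positivity)
  obtain ⟨f, hf, hf_supp, hf_mem, hf_cluster⟩ := exists_gradient_clusterPts_eq_of_tendsto h₁ h₂ h ht
    (fun k => ⟨(hF k).1, (hF k).2.1⟩) hη
  refine ⟨f, hf, hf_supp, fun y => ?_, fun K hKC hK hK0 => ?_⟩
  · exact (hf_mem y).elim fun k hk => interior_subset (hηC k hk)
  · obtain ⟨x, hx, hFx⟩ := hlim K hKC hK0
    exact ⟨x • e₁, hf_cluster K x hK hK0 hx hFx⟩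

end bumpSeries

section clarkeSubdifferential

variable {N : ℕ} {f : EuclideanSpace ℝ (Fin N) → ℝ} {x : EuclideanSpace ℝ (Fin N)}

theorem limitingGradients_eq_setOf_mapClusterPt (hf : Differentiable ℝ f)
    (x : EuclideanSpace ℝ (Fin N)) :
    limitingGradients f x = {q | MapClusterPt q (𝓝 x) (∇ f)} := by
  ext q
  refine ⟨fun ⟨u, _, hu, hq⟩ => MapClusterPt.of_comp hu hq.mapClusterPt, fun hq => ?_⟩
  have : (𝓝 x ⊓ comap (∇ f) (𝓝 q)).NeBot := by
    rw [neBot_inf_comap_iff_map, inf_comm]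
    exact hq
  obtain ⟨u, hu⟩ := exists_seq_tendsto (𝓝 x ⊓ comap (∇ f) (𝓝 q))
  obtain ⟨hux, huq⟩ := tendsto_inf.1 hu
  exact ⟨u, fun n => hf (u n), hux, (tendsto_comap_iff (g := ∇ f)).1 huq⟩

theorem clarkeSubdifferential_subset {C : Set (EuclideanSpace ℝ (Fin N))} (hC : IsClosed C)
    (hconv : Convex ℝ C) (hf : ∀ y, ∇ f y ∈ C) : clarkeSubdifferential f x ⊆ C :=
  convexHull_min (fun _ ⟨_, _, _, hq⟩ => hC.mem_of_tendsto hq (Eventually.of_forall fun _ => hf _))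
    hconv

theorem lipschitzWith_of_norm_gradient_le {E : Type*} [NormedAddCommGroup E]
    [InnerProductSpace ℝ E] [CompleteSpace E] {f : E → ℝ} {L : ℝ≥0} (hf : Differentiable ℝ f)
    (hL : ∀ y, ‖∇ f y‖ ≤ L) : LipschitzWith L f := by
  refine lipschitzWith_of_nnnorm_fderiv_le hf fun y => ?_
  rw [← toDual_gradient, LinearIsometryEquiv.nnnorm_map]
  exact hL y

theorem exists_clarkeSubdifferential_eq_of_zero_mem_interior (hN : 2 ≤ N)
    {C : Set (EuclideanSpace ℝ (Fin N))} (hconv : Convex ℝ C) (hC : IsCompact C)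
    (h0 : 0 ∈ interior C) {L : ℝ≥0} (hL : ∀ q ∈ C, ‖q‖ ≤ L) :
    ∃ f : EuclideanSpace ℝ (Fin N) → ℝ,
      Differentiable ℝ f ∧ LipschitzWith L f ∧ HasCompactSupport f ∧
      (∀ K ∈ compactConvexSubsetsZero C, ∃ x, clarkeSubdifferential f x = K) ∧
      ∀ x, clarkeSubdifferential f x ⊆ C := by
  obtain ⟨f, hf, hf_supp, hf_mem, hf_cluster⟩ :=
    exists_gradient_clusterPts_eq (finrank_euclideanSpace_fin (𝕜 := ℝ) ▸ hN) hC hconv h0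
  refine ⟨f, hf, lipschitzWith_of_norm_gradient_le hf fun y => hL _ (hf_mem y), hf_supp,
    fun K ⟨⟨hKC, hKne, hK, hKconv⟩, hK0⟩ => ?_,
    fun x => clarkeSubdifferential_subset hC.isClosed hconv hf_mem⟩
  obtain ⟨x, hx⟩ := hf_cluster ⟨⟨K, hK⟩, hKne⟩ hKC hKconv hK0
  refine ⟨x, ?_⟩
  rw [clarkeSubdifferential, limitingGradients_eq_setOf_mapClusterPt hf, hx]
  exact hKconv.convexHull_eq

theorem clarkeSubdifferential_zero (x : EuclideanSpace ℝ (Fin N)) :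
    clarkeSubdifferential (0 : EuclideanSpace ℝ (Fin N) → ℝ) x = {0} := by
  have hgrad : ∇ (0 : EuclideanSpace ℝ (Fin N) → ℝ) = 0 :=
    funext fun y => gradient_const y 0
  refine Subset.antisymm (clarkeSubdifferential_subset isClosed_singleton (convex_singleton 0)
    fun y => congrFun hgrad y) (singleton_subset_iff.2 (subset_convexHull ℝ _ ?_))
  exact ⟨fun _ => x, fun _ => differentiableAt_const 0, tendsto_const_nhds, by
    rw [hgrad]; exact tendsto_const_nhds⟩

theorem exists_clarkeSubdifferential_eq_of_subset_closedBall (hN : 2 ≤ N) (L : ℝ≥0) :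
    ∃ f : EuclideanSpace ℝ (Fin N) → ℝ,
      Differentiable ℝ f ∧ LipschitzWith L f ∧ HasCompactSupport f ∧
      ∀ K ∈ compactConvexSubsetsZero (closedBall 0 L), ∃ x, clarkeSubdifferential f x = K := by
  rcases eq_zero_or_pos L with rfl | hL
  · refine ⟨0, differentiable_const 0, LipschitzWith.const 0, HasCompactSupport.zero,
      fun K ⟨⟨hK, _⟩, hK0⟩ => ⟨0, ?_⟩⟩
    rw [NNReal.coe_zero, closedBall_zero] at hK
    rw [clarkeSubdifferential_zero, eq_singleton_iff_unique_mem.2 ⟨hK0, fun q hq => hK hq⟩]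
  · obtain ⟨f, hf, hf_lip, hf_supp, hf_clarke, -⟩ :=
      exists_clarkeSubdifferential_eq_of_zero_mem_interior hN (convex_closedBall 0 (L : ℝ))
        (isCompact_closedBall 0 (L : ℝ))
        (ball_subset_interior_closedBall (mem_ball_self (NNReal.coe_pos.2 hL)))
        (fun q hq => mem_closedBall_zero_iff.1 hq)
    exact ⟨f, hf, hf_lip, hf_supp, hf_clarke⟩

end clarkeSubdifferential

theorem mainTheorem5 (N : ℕ) (hN : 2 ≤ N)
    (C : Set (EuclideanSpace ℝ (Fin N))) (hCconv : Convex ℝ C) (hCcomp : IsCompact C)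
    (hC0 : (0 : EuclideanSpace ℝ (Fin N)) ∈ C)
    (L : ℝ≥0) (hL : IsGreatest ((fun x : EuclideanSpace ℝ (Fin N) => ‖x‖) '' C) (L : ℝ)) :
    (∃ f : EuclideanSpace ℝ (Fin N) → ℝ,
      Differentiable ℝ f ∧ LipschitzWith L f ∧ HasCompactSupport f ∧
      ∀ K ∈ compactConvexSubsetsZero C, ∃ x, clarkeSubdifferential f x = K) ∧
    ((0 : EuclideanSpace ℝ (Fin N)) ∈ interior C →
      ∃ f : EuclideanSpace ℝ (Fin N) → ℝ,
        Differentiable ℝ f ∧ LipschitzWith L f ∧ HasCompactSupport f ∧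
        (∀ K ∈ compactConvexSubsetsZero C, ∃ x, clarkeSubdifferential f x = K) ∧
        ∀ x, clarkeSubdifferential f x ⊆ C) := by
  have hCL (q) (hq : q ∈ C) : ‖q‖ ≤ L := hL.2 (mem_image_of_mem _ hq)
  refine ⟨?_, fun h0 =>
    exists_clarkeSubdifferential_eq_of_zero_mem_interior hN hCconv hCcomp h0 hCL⟩
  obtain ⟨f, hf, hf_lip, hf_supp, hf_clarke⟩ :=
    exists_clarkeSubdifferential_eq_of_subset_closedBall hN L
  refine ⟨f, hf, hf_lip, hf_supp, fun K ⟨⟨hKC, hK⟩, hK0⟩ => hf_clarke K ⟨⟨?_, hK⟩, hK0⟩⟩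
  exact fun q hq => mem_closedBall_zero_iff.2 (hCL q (hKC hq))
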